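/- Let $(\Omega_j,\mathcal M_j,\mu_j)$ $(j=1,2)$ be $\sigma$-finite measure spaces and let $L^2(\mu_j)$ be the corresponding complex $L^2$-spaces. A bounded operator $T:H_1\to H_2$ between complex Hilbert spaces belongs to the Schatten--von Neumann class $S_p(H_1,H_2)$, $0<p<\infty$, if it is compact and its singular values (the eigenvalues, counted with multiplicity, of $|T|=(T^*T)^{1/2}$) are $p$-summable; $S_p(H)=S_p(H,H)$. Let $E_j$ $(j=1,2)$ be a densely defined, not necessarily bounded, linear operator on $L^2(\mu_j)$ which is invertible, that is, maps its domain bijectively onto $L^2(\mu_j)$, with $E_j^{-1}\in S_{p_j}(L^2(\mu_j))$ for some $p_j>0$. Let $K\in L^2(\mu_2\otimes\mu_1)$ and let $T:L^2(\mu_1)\to L^2(\mu_2)$ be the integral operator $$(Tf)(x)=\int_{\Omega_1}K(x,y)f(y)\,d\mu_1(y).$$ For measurable functions $G,F$ on $\Omega_2\times\Omega_1$ we write $(E_2)_xG=F$ if for $\mu_1$-almost every $y$ the function $G(\cdot,y)$ belongs to the domain of $E_2$ and $E_2(G(\cdot,y))=F(\cdot,y)$; and $(E_1)_yG=F$ if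 for $\mu_2$-almost every $x$ the function $G(x,\cdot)$ belongs to the domain of $E_1$ and $E_1(G(x,\cdot))=F(x,\cdot)$. A condition such as $(E_2)_xK\in L^2(\mu_2\otimes\mu_1)$ means that $(E_2)_xK=F$ for some $F\in L^2(\mu_2\otimes\mu_1)$, and $(E_2)_x(E_1)_yK\in L^2(\mu_2\otimes\mu_1)$ means that $(E_1)_yK=G$ for some measurable $G$ with $(E_2)_xG\in L^2(\mu_2\otimes\mu_1)$. Then the following holds. (i) If $(E_2)_x(E_1)_yK\in L^2(\mu_2\otimes\mu_1)$, then $T\in S_r(L^2(\mu_1),L^2(\mu_2))$ for $\dfrac1r=\dfrac12+\dfrac1{p_1}+\dfrac1{p_2}$. (ii) If $(E_2)_xK\in L^2(\mu_2\otimes\mu_1)$, then $T\in S_r(L^2(\mu_1),L^2(\mu_2))$ for $\dfrac1r=\dfrac12+\dfrac1{p_2}$. (iii) If $(E_1)_yK\in L^2(\mu_2\otimes\mu_1)$, then $T\in S_r(L^2(\mu_1),L^2(\mu_2))$ for $\dfrac1r=\dfrac12+\dfrac1{p_1}$. -/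

import Mathlib

open MeasureTheory
open scoped ENNReal

set_option linter.unusedSectionVars false

noncomputable section

/-! ### Schatten-von Neumann classes -/

/-- The absolute value `|T| = (T* T)^(1/2)` of a bounded operator between two Hilbert spaces. -/
def absOp {H₁ H₂ : Type*} [NormedAddCommGroup H₁] [InnerProductSpace ℂ H₁] [CompleteSpace H₁]
    [NormedAddCommGroup H₂] [InnerProductSpace ℂ H₂] [CompleteSpace H₂]
    (T : H₁ →L[ℂ] H₂) : H₁ →L[ℂ] H₁ :=
  CFC.sqrt ((ContinuousLinearMap.adjoint T).comp T)

/-- `T` belongs to the Schatten-von Neumann class `S_p(H₁, H₂)`, `0 < p < ∞`: the operator `T` is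
compact and its singular values, that is the eigenvalues of `|T|` belonging to an orthonormal basis
`ψ` of `H₁` that consists of eigenvectors of `|T|`, are `p`-summable. (Indexing the basis by a set
of vectors is no restriction, and summability does not depend on an enumeration.) -/
def IsSchatten {H₁ H₂ : Type*} [NormedAddCommGroup H₁] [InnerProductSpace ℂ H₁] [CompleteSpace H₁]
    [NormedAddCommGroup H₂] [InnerProductSpace ℂ H₂] [CompleteSpace H₂]
    (p : ℝ) (T : H₁ →L[ℂ] H₂) : Prop :=
  IsCompactOperator T ∧
    ∃ (w : Set H₁) (ψ : HilbertBasis w ℂ H₁) (s : w → ℝ),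
      (∀ k, 0 ≤ s k) ∧ (∀ k, absOp T (ψ k) = (s k : ℂ) • ψ k) ∧ Summable (fun k => s k ^ p)

/-! ### Unbounded operators with bounded inverse -/

/-- The bounded operator `R`, defined on all of `H`, is the inverse of the (possibly unbounded)
operator `E` on `H`. -/
structure IsInverseOf {H : Type*} [NormedAddCommGroup H] [InnerProductSpace ℂ H]
    (R : H →L[ℂ] H) (E : H →ₗ.[ℂ] H) : Prop where
  left_inv : ∀ φ : E.domain, R (E φ) = φ
  right_inv : ∀ g : H, ∃ φ : E.domain, (φ : H) = R g ∧ E φ = g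

/-- The operator `E` is invertible and `E⁻¹ ∈ S_p(H)`. -/
def InverseIsSchatten {H : Type*} [NormedAddCommGroup H] [InnerProductSpace ℂ H] [CompleteSpace H]
    (p : ℝ) (E : H →ₗ.[ℂ] H) : Prop :=
  ∃ R : H →L[ℂ] H, IsInverseOf R E ∧ IsSchatten p R

/-! ### Operators acting on one of the two variables of a function `K(x, y)` -/

section Partial

variable {Ω₁ Ω₂ : Type*} [MeasurableSpace Ω₁] [MeasurableSpace Ω₂]

/-- `E_x K = F`: for almost every `y` the function `K(·, y)` belongs to the domain of `E`, and
`E` maps it to `F(·, y)`. -/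
def ActsOnX (μ₁ : Measure Ω₁) (μ₂ : Measure Ω₂) (E : Lp ℂ 2 μ₂ →ₗ.[ℂ] Lp ℂ 2 μ₂)
    (K F : Ω₂ × Ω₁ → ℂ) : Prop :=
  ∀ᵐ y ∂μ₁, ∃ φ : E.domain,
    ((φ : Lp ℂ 2 μ₂) : Ω₂ → ℂ) =ᵐ[μ₂] (fun x => K (x, y)) ∧
    (E φ : Ω₂ → ℂ) =ᵐ[μ₂] (fun x => F (x, y))

/-- `E_y K = F`: for almost every `x` the function `K(x, ·)` belongs to the domain of `E`, and
`E` maps it to `F(x, ·)`. -/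
def ActsOnY (μ₁ : Measure Ω₁) (μ₂ : Measure Ω₂) (E : Lp ℂ 2 μ₁ →ₗ.[ℂ] Lp ℂ 2 μ₁)
    (K F : Ω₂ × Ω₁ → ℂ) : Prop :=
  ∀ᵐ x ∂μ₂, ∃ φ : E.domain,
    ((φ : Lp ℂ 2 μ₁) : Ω₁ → ℂ) =ᵐ[μ₁] (fun y => K (x, y)) ∧
    (E φ : Ω₁ → ℂ) =ᵐ[μ₁] (fun y => F (x, y))

/-- `E_x K ∈ L²(μ₂ ⊗ μ₁)`. -/
def XImageMemL2 (μ₁ : Measure Ω₁) (μ₂ : Measure Ω₂) (E : Lp ℂ 2 μ₂ →ₗ.[ℂ] Lp ℂ 2 μ₂)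
    (K : Ω₂ × Ω₁ → ℂ) : Prop :=
  ∃ F : Ω₂ × Ω₁ → ℂ, MemLp F 2 (μ₂.prod μ₁) ∧ ActsOnX μ₁ μ₂ E K F

/-- `E_y K ∈ L²(μ₂ ⊗ μ₁)`. -/
def YImageMemL2 (μ₁ : Measure Ω₁) (μ₂ : Measure Ω₂) (E : Lp ℂ 2 μ₁ →ₗ.[ℂ] Lp ℂ 2 μ₁)
    (K : Ω₂ × Ω₁ → ℂ) : Prop :=
  ∃ F : Ω₂ × Ω₁ → ℂ, MemLp F 2 (μ₂.prod μ₁) ∧ ActsOnY μ₁ μ₂ E K F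

/-- `(E₂)_x (E₁)_y K ∈ L²(μ₂ ⊗ μ₁)`: the function `G = (E₁)_y K` is a measurable function on the
product, not assumed to be square integrable there, and `(E₂)_x G ∈ L²(μ₂ ⊗ μ₁)`. -/
def XYImageMemL2 (μ₁ : Measure Ω₁) (μ₂ : Measure Ω₂) (E₁ : Lp ℂ 2 μ₁ →ₗ.[ℂ] Lp ℂ 2 μ₁)
    (E₂ : Lp ℂ 2 μ₂ →ₗ.[ℂ] Lp ℂ 2 μ₂) (K : Ω₂ × Ω₁ → ℂ) : Prop :=
  ∃ G : Ω₂ × Ω₁ → ℂ, AEStronglyMeasurable G (μ₂.prod μ₁) ∧ ActsOnY μ₁ μ₂ E₁ K G ∧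
    XImageMemL2 μ₁ μ₂ E₂ G

end Partial

/-! ### Integral operators with square integrable kernel -/

section IntegralOperator

variable {Ω₁ Ω₂ : Type*} [MeasurableSpace Ω₁] [MeasurableSpace Ω₂]

/-- `(T f)(x) = ∫ K(x, y) f(y) dμ₁(y)`. -/
def kernelIntegral (μ₁ : Measure Ω₁) (K : Ω₂ × Ω₁ → ℂ) (f : Ω₁ → ℂ) (x : Ω₂) : ℂ :=
  ∫ y, K (x, y) * f y ∂μ₁

variable {μ₁ : Measure Ω₁} {μ₂ : Measure Ω₂} [SigmaFinite μ₁] [SigmaFinite μ₂]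
  {K : Ω₂ × Ω₁ → ℂ} {f : Ω₁ → ℂ}

lemma eLpNorm_two_sq {Ω : Type*} [MeasurableSpace Ω] (μ : Measure Ω) (g : Ω → ℂ) :
    eLpNorm g 2 μ ^ 2 = ∫⁻ x, ‖g x‖ₑ ^ 2 ∂μ := by
  have h := eLpNorm_nnreal_pow_eq_lintegral (f := g) (μ := μ) (p := 2) two_ne_zero
  simpa using h

lemma lintegral_fiber_eLpNorm (hK : MemLp K 2 (μ₂.prod μ₁)) :
    ∫⁻ x, eLpNorm (fun y => K (x, y)) 2 μ₁ ^ 2 ∂μ₂ = eLpNorm K 2 (μ₂.prod μ₁) ^ 2 := by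
  simp_rw [eLpNorm_two_sq]
  rw [lintegral_prod]
  exact hK.1.enorm.pow_const 2

lemma fiber_memLp (hK : MemLp K 2 (μ₂.prod μ₁)) :
    ∀ᵐ x ∂μ₂, MemLp (fun y => K (x, y)) 2 μ₁ := by
  have hm : AEMeasurable (fun x => eLpNorm (fun y => K (x, y)) 2 μ₁ ^ 2) μ₂ := by
    simp_rw [eLpNorm_two_sq]
    exact (hK.1.enorm.pow_const 2).lintegral_prod_right'
  have hfin : ∫⁻ x, eLpNorm (fun y => K (x, y)) 2 μ₁ ^ 2 ∂μ₂ ≠ ∞ := by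
    rw [lintegral_fiber_eLpNorm hK]
    exact ENNReal.pow_ne_top hK.2.ne
  filter_upwards [hK.1.prodMk_left, ae_lt_top' hm hfin] with x h1 h2
  refine ⟨h1, ?_⟩
  by_contra h
  rw [not_lt, top_le_iff] at h
  simp [h] at h2

lemma fiber_integrable (hK : MemLp K 2 (μ₂.prod μ₁)) (hf : MemLp f 2 μ₁) :
    ∀ᵐ x ∂μ₂, Integrable (fun y => K (x, y) * f y) μ₁ := by
  filter_upwards [fiber_memLp hK] with x hx
  exact hx.integrable_mul hf

lemma kernelIntegral_aestronglyMeasurable (hK : MemLp K 2 (μ₂.prod μ₁)) (hf : MemLp f 2 μ₁) :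
    AEStronglyMeasurable (kernelIntegral μ₁ K f) μ₂ := by
  have h : AEStronglyMeasurable (fun z : Ω₂ × Ω₁ => K z * f z.2) (μ₂.prod μ₁) :=
    hK.1.mul hf.1.comp_snd
  exact h.integral_prod_right'

lemma enorm_kernelIntegral_le (hK : MemLp K 2 (μ₂.prod μ₁)) (hf : MemLp f 2 μ₁) :
    ∀ᵐ x ∂μ₂, ‖kernelIntegral μ₁ K f x‖ₑ ≤
      eLpNorm (fun y => K (x, y)) 2 μ₁ * eLpNorm f 2 μ₁ := by
  filter_upwards [fiber_memLp hK] with x hx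
  refine (enorm_integral_le_lintegral_enorm _).trans ?_
  rw [← eLpNorm_one_eq_lintegral_enorm]
  have h := eLpNorm_smul_le_mul_eLpNorm (p := 2) (q := 2) (r := 1) hf.1 hx.1
  have h' : ((fun y => K (x, y)) • f) = fun y => K (x, y) * f y := rfl
  rwa [h'] at h

lemma eLpNorm_kernelIntegral_le (hK : MemLp K 2 (μ₂.prod μ₁)) (hf : MemLp f 2 μ₁) :
    eLpNorm (kernelIntegral μ₁ K f) 2 μ₂ ≤ eLpNorm K 2 (μ₂.prod μ₁) * eLpNorm f 2 μ₁ := by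
  have h : eLpNorm (kernelIntegral μ₁ K f) 2 μ₂ ^ 2 ≤
      (eLpNorm K 2 (μ₂.prod μ₁) * eLpNorm f 2 μ₁) ^ 2 := by
    rw [eLpNorm_two_sq, mul_pow, ← lintegral_fiber_eLpNorm hK,
      ← lintegral_mul_const' _ _ (ENNReal.pow_ne_top hf.2.ne)]
    refine lintegral_mono_ae ?_
    filter_upwards [enorm_kernelIntegral_le hK hf] with x hx
    rw [← mul_pow]
    gcongr
  exact (ENNReal.pow_le_pow_left_iff two_ne_zero).1 h

lemma kernelIntegral_memLp (hK : MemLp K 2 (μ₂.prod μ₁)) (hf : MemLp f 2 μ₁) :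
    MemLp (kernelIntegral μ₁ K f) 2 μ₂ :=
  ⟨kernelIntegral_aestronglyMeasurable hK hf,
    (eLpNorm_kernelIntegral_le hK hf).trans_lt (ENNReal.mul_lt_top hK.2 hf.2)⟩

/-- The integral operator `T : L²(μ₁) → L²(μ₂)` with kernel `K ∈ L²(μ₂ ⊗ μ₁)`. -/
def integralOperator (K : Ω₂ × Ω₁ → ℂ) (hK : MemLp K 2 (μ₂.prod μ₁)) :
    Lp ℂ 2 μ₁ →L[ℂ] Lp ℂ 2 μ₂ :=
  LinearMap.mkContinuous
    { toFun := fun f => (kernelIntegral_memLp hK (Lp.memLp f)).toLp (kernelIntegral μ₁ K f)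
      map_add' := fun f g => by
        rw [← MemLp.toLp_add, MemLp.toLp_eq_toLp_iff]
        filter_upwards [fiber_integrable hK (Lp.memLp f), fiber_integrable hK (Lp.memLp g)]
          with x hf hg
        simp only [kernelIntegral, Pi.add_apply]
        rw [← integral_add hf hg]
        refine integral_congr_ae ?_
        filter_upwards [Lp.coeFn_add f g] with y hy
        rw [hy, Pi.add_apply, mul_add]
      map_smul' := fun c f => by
        rw [RingHom.id_apply, ← MemLp.toLp_const_smul, MemLp.toLp_eq_toLp_iff]
        refine Filter.Eventually.of_forall fun x => ?_
        simp only [kernelIntegral, Pi.smul_apply]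
        rw [← integral_smul]
        refine integral_congr_ae ?_
        filter_upwards [Lp.coeFn_smul c f] with y hy
        rw [hy, Pi.smul_apply, mul_smul_comm] }
    (eLpNorm K 2 (μ₂.prod μ₁)).toReal
    (fun f => by
      simp only [LinearMap.coe_mk, AddHom.coe_mk, Lp.norm_toLp]
      rw [Lp.norm_def, ← ENNReal.toReal_mul]
      exact ENNReal.toReal_mono (ENNReal.mul_ne_top hK.2.ne (Lp.memLp f).2.ne)
        (eLpNorm_kernelIntegral_le hK (Lp.memLp f)))

/-- The defining formula of the integral operator. -/
lemma integralOperator_ae (hK : MemLp K 2 (μ₂.prod μ₁)) (f : Lp ℂ 2 μ₁) :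
    ∀ᵐ x ∂μ₂, integralOperator K hK f x = ∫ y, K (x, y) * f y ∂μ₁ :=
  (kernelIntegral_memLp hK (Lp.memLp f)).coeFn_toLp

end IntegralOperator

end

/-! Write `R₁`, `R₂` for the bounded inverses of `E₁`, `E₂`, and `T_F` for the integral operator
with kernel `F`. If applying `E₂` in `x` and `E₁` in `y` turns `K` into `F ∈ L²`, then undoing this
on the fibres gives `T_K = R₂ ∘ T_F ∘ R₁ᵗ`, with the transpose taken for the bilinear pairing `∫ f
g` (`integralOperator_eq_comp`, `integralOperator_eq_comp_conjOp`). The middle factor is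
Hilbert-Schmidt by Bessel's inequality on the fibres, and the outer ones lie in `S_{p₂}` and
`S_{p₁}`; exponents add under composition.

This addition rule is awkward for eigenvalues of `|T|` but easy for approximation numbers `a_n`:
there `a_{m+n}(ST) ≤ a_m(S) a_n(T)`, and Hölder's inequality for sequences finishes
(`approxNumber_summable_comp`). The bridge is `isSchatten_iff_summable_approxNumber`. Singular
values are never enumerated in decreasing order; greedy selection of indices and induction over
finite sets take the place of an ordering. -/

/-! ### Operators of finite rank and approximation numbers -/

section ApproximationNumbers

variable {H₁ H₂ H₃ : Type*} [NormedAddCommGroup H₁] [InnerProductSpace ℂ H₁]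
  [NormedAddCommGroup H₂] [InnerProductSpace ℂ H₂] [NormedAddCommGroup H₃] [InnerProductSpace ℂ H₃]

/-- The range of `F` is contained in the span of at most `n` vectors. -/
def HasRankLE (F : H₁ →L[ℂ] H₂) (n : ℕ) : Prop :=
  ∃ s : Finset H₂, s.card ≤ n ∧ ∀ x, F x ∈ Submodule.span ℂ (s : Set H₂)

namespace HasRankLE

lemma zero (n : ℕ) : HasRankLE (0 : H₁ →L[ℂ] H₂) n := ⟨∅, by simp, by simp⟩

lemma mono {F : H₁ →L[ℂ] H₂} {m n : ℕ} (h : HasRankLE F m) (hmn : m ≤ n) : HasRankLE F n :=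
  let ⟨s, hs, hF⟩ := h
  ⟨s, hs.trans hmn, hF⟩

lemma add {F G : H₁ →L[ℂ] H₂} {m n : ℕ} (hF : HasRankLE F m) (hG : HasRankLE G n) :
    HasRankLE (F + G) (m + n) := by
  classical
  obtain ⟨s, hs, hF⟩ := hF
  obtain ⟨t, ht, hG⟩ := hG
  refine ⟨s ∪ t, (Finset.card_union_le _ _).trans (add_le_add hs ht), fun x => ?_⟩
  rw [Finset.coe_union]
  exact add_mem (Submodule.span_mono Set.subset_union_left (hF x))
    (Submodule.span_mono Set.subset_union_right (hG x))

lemma comp_left {F : H₁ →L[ℂ] H₂} {n : ℕ} (hF : HasRankLE F n) (S : H₂ →L[ℂ] H₃) :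
    HasRankLE (S.comp F) n := by
  classical
  obtain ⟨s, hs, hF⟩ := hF
  refine ⟨s.image S, Finset.card_image_le.trans hs, fun x => ?_⟩
  have h := Submodule.mem_map_of_mem (f := (S : H₂ →ₗ[ℂ] H₃)) (hF x)
  rw [Submodule.map_span] at h
  simpa using h

lemma comp_right {F : H₂ →L[ℂ] H₃} {n : ℕ} (hF : HasRankLE F n) (S : H₁ →L[ℂ] H₂) :
    HasRankLE (F.comp S) n :=
  let ⟨s, hs, hF⟩ := hF
  ⟨s, hs, fun x => hF (S x)⟩

/-- The adjoint vanishes on the orthogonal complement of the range of `F`, so `F* = F* P_V` for the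
span `V` of `s`, and the vectors `F* v`, `v ∈ s`, suffice. -/
lemma adjoint [CompleteSpace H₁] [CompleteSpace H₂] {F : H₁ →L[ℂ] H₂} {n : ℕ}
    (hF : HasRankLE F n) : HasRankLE (ContinuousLinearMap.adjoint F) n := by
  classical
  obtain ⟨s, hs, hF⟩ := hF
  refine ⟨s.image (ContinuousLinearMap.adjoint F), Finset.card_image_le.trans hs, fun x => ?_⟩
  let V := Submodule.span ℂ (s : Set H₂)
  have hx : ContinuousLinearMap.adjoint F x =
      ContinuousLinearMap.adjoint F (V.starProjection x) := by
    refine ext_inner_right ℂ fun y => ?_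
    rw [ContinuousLinearMap.adjoint_inner_left, ContinuousLinearMap.adjoint_inner_left,
      ← sub_eq_zero, ← inner_sub_left]
    exact Submodule.inner_left_of_mem_orthogonal (hF y)
      (Submodule.sub_starProjection_mem_orthogonal x)
  have h := Submodule.mem_map_of_mem (f := (ContinuousLinearMap.adjoint F : H₂ →ₗ[ℂ] H₁))
    (Submodule.starProjection_apply_mem V x)
  rw [hx, Finset.coe_image]
  exact (Submodule.map_span (ContinuousLinearMap.adjoint F : H₂ →ₗ[ℂ] H₁) (s : Set H₂)).le h

lemma isCompactOperator {F : H₁ →L[ℂ] H₂} {n : ℕ} (hF : HasRankLE F n) :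
    IsCompactOperator F := by
  obtain ⟨s, -, hF⟩ := hF
  have : ProperSpace (Submodule.span ℂ (s : Set H₂)) := FiniteDimensional.proper ℂ _
  have h : IsCompactOperator (F.codRestrict (Submodule.span ℂ (s : Set H₂)) hF) :=
    isCompactOperator_of_locallyCompactSpace_dom _
  exact h.clm_comp (Submodule.subtypeL _)

end HasRankLE

/-- The `n`-th approximation number of `T`: the distance to the operators of rank at most `n`. -/
noncomputable def approxNumber (T : H₁ →L[ℂ] H₂) (n : ℕ) : ℝ :=
  Metric.infDist T {F | HasRankLE F n}

lemma approxNumber_nonneg (T : H₁ →L[ℂ] H₂) (n : ℕ) : 0 ≤ approxNumber T n :=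
  Metric.infDist_nonneg

lemma approxNumber_le {T F : H₁ →L[ℂ] H₂} {n : ℕ} (hF : HasRankLE F n) :
    approxNumber T n ≤ ‖T - F‖ := by
  rw [← dist_eq_norm]
  exact Metric.infDist_le_dist_of_mem hF

lemma exists_norm_sub_lt {T : H₁ →L[ℂ] H₂} {n : ℕ} {c : ℝ} (h : approxNumber T n < c) :
    ∃ F : H₁ →L[ℂ] H₂, HasRankLE F n ∧ ‖T - F‖ < c := by
  obtain ⟨F, hF, h⟩ := (Metric.infDist_lt_iff ⟨0, HasRankLE.zero n⟩).1 h
  exact ⟨F, hF, by rwa [← dist_eq_norm]⟩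

lemma le_approxNumber {T : H₁ →L[ℂ] H₂} {n : ℕ} {c : ℝ}
    (h : ∀ F : H₁ →L[ℂ] H₂, HasRankLE F n → c ≤ ‖T - F‖) : c ≤ approxNumber T n := by
  by_contra! hc
  obtain ⟨F, hF, h'⟩ := exists_norm_sub_lt hc
  exact absurd (h F hF) h'.not_ge

lemma approxNumber_antitone (T : H₁ →L[ℂ] H₂) : Antitone (approxNumber T) := fun _ _ hmn =>
  le_approxNumber fun _ hF => approxNumber_le (hF.mono hmn)

/-- Rests on `ST - (F(T - G) + SG) = (S - F)(T - G)`: the subtracted operator has rank at most `m +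
n`, and the right side has norm at most the product of the two errors. -/
lemma approxNumber_comp_le (S : H₂ →L[ℂ] H₃) (T : H₁ →L[ℂ] H₂) (m n : ℕ) :
    approxNumber (S.comp T) (m + n) ≤ approxNumber S m * approxNumber T n := by
  refine le_mul_of_forall_lt₀ fun a ha b hb => ?_
  obtain ⟨F, hF, hFa⟩ := exists_norm_sub_lt ha
  obtain ⟨G, hG, hGb⟩ := exists_norm_sub_lt hb
  have h := (hF.comp_right (T - G)).add (hG.comp_left S)
  refine (approxNumber_le h).trans ?_
  have h' : S.comp T - (F.comp (T - G) + S.comp G) = (S - F).comp (T - G) := by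
    ext x
    simp
    abel
  rw [h']
  refine (ContinuousLinearMap.opNorm_comp_le _ _).trans ?_
  gcongr
  exact (norm_nonneg _).trans hFa.le

lemma approxNumber_adjoint_le [CompleteSpace H₁] [CompleteSpace H₂] (T : H₁ →L[ℂ] H₂) (n : ℕ) :
    approxNumber (ContinuousLinearMap.adjoint T) n ≤ approxNumber T n := by
  refine le_approxNumber fun F hF => (approxNumber_le hF.adjoint).trans_eq ?_
  rw [← map_sub ContinuousLinearMap.adjoint T F]
  exact ContinuousLinearMap.adjoint.norm_map (T - F)

/-- Hölder's inequality controls the even indices through `a_{2n}(ST) ≤ a_n(S) a_n(T)`; monotonicity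
then covers the odd ones. -/
lemma approxNumber_summable_comp {S : H₂ →L[ℂ] H₃} {T : H₁ →L[ℂ] H₂} {p q r : ℝ} (hp : 0 < p)
    (hq : 0 < q) (hr : 1 / r = 1 / p + 1 / q) (hS : Summable fun n => approxNumber S n ^ p)
    (hT : Summable fun n => approxNumber T n ^ q) :
    Summable fun n => approxNumber (S.comp T) n ^ r := by
  have hr0 : 0 < r := one_div_pos.1 (hr ▸ by positivity)
  have hpqr : p.HolderTriple q r := ⟨by rw [← one_div, ← one_div, ← one_div, hr], hp, hq⟩
  have h : Summable fun n => (approxNumber S n * approxNumber T n) ^ r :=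
    Real.summable_Lr_of_Lp_Lq_of_nonneg hpqr (approxNumber_nonneg S) (approxNumber_nonneg T) hS hT
  have he : Summable fun n => approxNumber (S.comp T) (2 * n) ^ r := by
    refine h.of_nonneg_of_le (fun n => Real.rpow_nonneg (approxNumber_nonneg _ _) _) fun n => ?_
    refine Real.rpow_le_rpow (approxNumber_nonneg _ _) ?_ hr0.le
    rw [two_mul]
    exact approxNumber_comp_le S T n n
  have ho : Summable fun n => approxNumber (S.comp T) (2 * n + 1) ^ r := by
    refine he.of_nonneg_of_le (fun n => Real.rpow_nonneg (approxNumber_nonneg _ _) _) fun n => ?_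
    exact Real.rpow_le_rpow (approxNumber_nonneg _ _) (approxNumber_antitone _ (Nat.le_succ _))
      hr0.le
  exact (HasSum.even_add_odd (f := fun n => approxNumber (S.comp T) n ^ r) he.hasSum
    ho.hasSum).summable

/-- Summability forces `a_n → 0`, so `T` is a norm limit of finite rank operators. -/
lemma isCompactOperator_of_approxNumber_summable [CompleteSpace H₂] {T : H₁ →L[ℂ] H₂} {p : ℝ}
    (hp : 0 < p) (hT : Summable fun n => approxNumber T n ^ p) : IsCompactOperator T := by
  have hcl : IsClosed {F : H₁ →L[ℂ] H₂ | IsCompactOperator F} := isClosed_setOfPred_isCompactOperator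
  refine hcl.closure_subset (Metric.mem_closure_iff.2 fun ε hε => ?_)
  obtain ⟨n, hn⟩ := (hT.tendsto_atTop_zero.eventually_lt_const (Real.rpow_pos_of_pos hε p)).exists
  obtain ⟨F, hF, h⟩ := exists_norm_sub_lt
    ((Real.rpow_lt_rpow_iff (approxNumber_nonneg T n) hε.le hp).1 hn)
  exact ⟨F, hF.isCompactOperator, by rwa [dist_eq_norm]⟩

end ApproximationNumbers

/-! ### Singular values and approximation numbers -/

section SingularValues

variable {H H₁ H₂ : Type*} [NormedAddCommGroup H] [InnerProductSpace ℂ H] [CompleteSpace H]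
  [NormedAddCommGroup H₁] [InnerProductSpace ℂ H₁] [CompleteSpace H₁]
  [NormedAddCommGroup H₂] [InnerProductSpace ℂ H₂] [CompleteSpace H₂]

open ContinuousLinearMap (adjoint)

lemma adjoint_comp_self_nonneg (T : H₁ →L[ℂ] H₂) : 0 ≤ (adjoint T).comp T :=
  (ContinuousLinearMap.nonneg_iff_isPositive _).2
    (ContinuousLinearMap.isPositive_adjoint_comp_self T)

lemma absOp_absOp (T : H₁ →L[ℂ] H₂) (x : H₁) : absOp T (absOp T x) = adjoint T (T x) := by
  have h := CFC.sqrt_mul_sqrt_self _ (adjoint_comp_self_nonneg T)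
  exact DFunLike.congr_fun h x

lemma absOp_isPositive (T : H₁ →L[ℂ] H₂) : (absOp T).IsPositive :=
  (ContinuousLinearMap.nonneg_iff_isPositive _).1 (CFC.sqrt_nonneg _)

/-- Removes the square root: from here on only `T*T` is diagonalised. For the converse, `y = |T|x -
s x` satisfies `|T|y = -s y`, which positivity of `|T|` excludes unless `y = 0` or `s = 0`; in the
latter case `‖|T|x‖² = ⟪|T|²x, x⟫ = 0`. -/
lemma absOp_apply_eq_smul_iff {T : H₁ →L[ℂ] H₂} {s : ℝ} (hs : 0 ≤ s) {x : H₁} :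
    absOp T x = (s : ℂ) • x ↔ adjoint T (T x) = (s : ℂ) ^ 2 • x := by
  rw [← absOp_absOp]
  constructor
  · intro h
    rw [h, map_smul, h, smul_smul, sq]
  intro h
  set y := absOp T x - (s : ℂ) • x with hy
  have h1 : absOp T y = -((s : ℂ) • y) := by
    rw [hy, map_sub, h, map_smul, smul_sub, smul_smul, sq]
    abel
  have hpos := (absOp_isPositive T).re_inner_nonneg_left y
  rw [h1, inner_neg_left, inner_smul_left, Complex.conj_ofReal, inner_self_eq_norm_sq_to_K] at hpos
  have hs' : s * ‖y‖ ^ 2 ≤ 0 := by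
    simpa [← Complex.ofReal_pow] using hpos
  rcases hs.eq_or_lt with rfl | hs0
  · have h2 : inner ℂ (absOp T x) (absOp T x) = 0 := by
      rw [(absOp_isPositive T).isSymmetric.apply_clm, h]
      simp
    simpa using h2
  · have : ‖y‖ = 0 := by
      have := sq_nonneg ‖y‖
      exact pow_eq_zero_iff two_ne_zero |>.1 (by nlinarith)
    exact sub_eq_zero.1 (norm_eq_zero.1 this)

/-- Parseval's identity for `⟪x, T*T x⟫ = ‖T x‖²` in the eigenbasis. -/
lemma hasSum_norm_inner_sq {ι : Type*} (ψ : HilbertBasis ι ℂ H₁) {T : H₁ →L[ℂ] H₂} {s : ι → ℝ}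
    (h : ∀ k, adjoint T (T (ψ k)) = (s k : ℂ) ^ 2 • ψ k) (x : H₁) :
    HasSum (fun k => s k ^ 2 * ‖inner ℂ (ψ k) x‖ ^ 2) (‖T x‖ ^ 2) := by
  have h1 := ψ.hasSum_inner_mul_inner x (adjoint T (T x))
  rw [ContinuousLinearMap.adjoint_inner_right, inner_self_eq_norm_sq_to_K] at h1
  have h2 : (fun k => inner ℂ x (ψ k) * inner ℂ (ψ k) (adjoint T (T x))) =
      fun k => ((s k ^ 2 * ‖inner ℂ (ψ k) x‖ ^ 2 : ℝ) : ℂ) := by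
    ext k
    rw [ContinuousLinearMap.adjoint_inner_right, ← ContinuousLinearMap.adjoint_inner_left, h,
      inner_smul_left, ← inner_conj_symm x (ψ k)]
    push_cast
    rw [← Complex.conj_mul', map_pow, Complex.conj_ofReal]
    ring
  rw [h2] at h1
  refine Complex.hasSum_ofReal.1 ?_
  simpa using h1

lemma hasSum_norm_inner_sq_self {ι : Type*} (ψ : HilbertBasis ι ℂ H₁) (x : H₁) :
    HasSum (fun k => ‖inner ℂ (ψ k) x‖ ^ 2) (‖x‖ ^ 2) := by
  simpa using hasSum_norm_inner_sq ψ (T := ContinuousLinearMap.id ℂ H₁) (s := fun _ => 1)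
    (fun k => by
      rw [← ContinuousLinearMap.one_def, ← ContinuousLinearMap.star_eq_adjoint, star_one]
      simp) x

/-- Truncation: with `P` the projection onto the eigenvectors in `A`, the error `T - TP` sees only
the singular values outside `A`. -/
lemma approxNumber_card_le {ι : Type*} (ψ : HilbertBasis ι ℂ H₁) {T : H₁ →L[ℂ] H₂} {s : ι → ℝ}
    (hs : ∀ k, 0 ≤ s k) (h : ∀ k, adjoint T (T (ψ k)) = (s k : ℂ) ^ 2 • ψ k) {A : Finset ι}
    {n : ℕ} (hA : A.card ≤ n) {c : ℝ} (hc : 0 ≤ c) (hAc : ∀ k ∉ A, s k ≤ c) :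
    approxNumber T n ≤ c := by
  classical
  set P : H₁ →L[ℂ] H₁ := ∑ k ∈ A, (innerSL ℂ (ψ k)).smulRight (ψ k) with hP
  have hPx (x : H₁) : P x = ∑ k ∈ A, inner ℂ (ψ k) x • ψ k := by simp [hP]
  have hrank : HasRankLE P n := by
    refine ⟨A.image ψ, Finset.card_image_le.trans hA, fun x => ?_⟩
    rw [hPx]
    exact sum_mem fun k hk =>
      Submodule.smul_mem _ _ (Submodule.subset_span (by simpa using ⟨k, hk, rfl⟩))
  refine (approxNumber_le (hrank.comp_left T)).trans
    (ContinuousLinearMap.opNorm_le_bound _ hc fun x => ?_)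
  have hx : (T - T.comp P) x = T (x - P x) := by simp
  rw [hx, ← pow_le_pow_iff_left₀ (norm_nonneg _) (by positivity) two_ne_zero, mul_pow]
  refine hasSum_le (fun k => ?_) (hasSum_norm_inner_sq ψ h (x - P x))
    ((hasSum_norm_inner_sq_self ψ x).mul_left (c ^ 2))
  by_cases hk : k ∈ A
  · rw [inner_sub_right, hPx, ψ.orthonormal.inner_right_sum _ hk]
    simp
    positivity
  · have h0 : inner ℂ (ψ k) (P x) = 0 := by
      rw [hPx, inner_sum]
      refine Finset.sum_eq_zero fun j hj => ?_
      rw [inner_smul_right, ψ.orthonormal.2 (ne_of_mem_of_not_mem hj hk).symm, mul_zero]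
    rw [inner_sub_right, h0, sub_zero]
    gcongr
    · exact hs k
    · exact hAc k hk

/-- Dimension count: `F` of rank at most `n` kills some `x ≠ 0` in the span of the more than `n`
eigenvectors in `A`, and there `‖(T - F)x‖ = ‖T x‖ ≥ c ‖x‖`. -/
lemma le_approxNumber_card {ι : Type*} (ψ : HilbertBasis ι ℂ H₁) {T : H₁ →L[ℂ] H₂} {s : ι → ℝ}
    (h : ∀ k, adjoint T (T (ψ k)) = (s k : ℂ) ^ 2 • ψ k) {A : Finset ι}
    {n : ℕ} (hA : n < A.card) {c : ℝ} (hc : 0 ≤ c) (hAc : ∀ k ∈ A, c ≤ s k) :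
    c ≤ approxNumber T n := by
  classical
  refine le_approxNumber fun F ⟨t, ht, hF⟩ => ?_
  let V := Submodule.span ℂ (t : Set H₂)
  let L : (A → ℂ) →ₗ[ℂ] V :=
    ((F : H₁ →ₗ[ℂ] H₂).codRestrict V hF).comp (Fintype.linearCombination ℂ fun k : A => ψ k)
  have hL : LinearMap.ker L ≠ ⊥ := by
    refine L.ker_ne_bot_of_finrank_lt ?_
    rw [Module.finrank_fintype_fun_eq_card, Fintype.card_coe]
    exact ((finrank_span_finset_le_card t).trans ht).trans_lt hA
  obtain ⟨l, hl, hl0⟩ := Submodule.exists_mem_ne_zero_of_ne_bot hL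
  set x : H₁ := ∑ k : A, l k • ψ k with hx
  have hFx : F x = 0 := by
    have := congrArg Subtype.val (LinearMap.mem_ker.1 hl)
    simpa [L, Fintype.linearCombination_apply, hx] using this
  have hψ : Orthonormal ℂ fun k : A => ψ k := ψ.orthonormal.comp _ Subtype.val_injective
  have hx0 : x ≠ 0 := fun h0 => hl0 <| funext fun k =>
    Fintype.linearIndependent_iff.1 hψ.linearIndependent l (hx ▸ h0) k
  have hle : c * ‖x‖ ≤ ‖T x‖ := by
    rw [← pow_le_pow_iff_left₀ (by positivity) (norm_nonneg _) two_ne_zero, mul_pow]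
    refine hasSum_le (fun k => ?_) ((hasSum_norm_inner_sq_self ψ x).mul_left (c ^ 2))
      (hasSum_norm_inner_sq ψ h x)
    by_cases hk : k ∈ A
    · gcongr
      exact hAc k hk
    · have h0 : inner ℂ (ψ k) x = 0 := by
        rw [hx, inner_sum]
        refine Finset.sum_eq_zero fun j _ => ?_
        rw [inner_smul_right, ψ.orthonormal.2 (ne_of_mem_of_not_mem j.2 hk).symm, mul_zero]
      simp [h0]
  have h1 : ‖T x‖ ≤ ‖T - F‖ * ‖x‖ := by
    simpa [hFx] using (T - F).le_opNorm x
  exact le_of_mul_le_mul_right (hle.trans h1) (norm_pos_iff.2 hx0)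

/-- The factor `1/2` is the loss in the two greedy selections below, which find a vector only up to
a constant; it does not affect summability. -/
lemma summable_approxNumber_of_sum_range_le {T : H₁ →L[ℂ] H₂} {p C : ℝ}
    (h : ∀ N, ∑ n ∈ Finset.range N, (approxNumber T n / 2) ^ p ≤ C) :
    Summable fun n => approxNumber T n ^ p := by
  have h1 : Summable fun n => (approxNumber T n / 2) ^ p :=
    summable_of_sum_range_le
      (fun n => Real.rpow_nonneg (div_nonneg (approxNumber_nonneg T n) zero_le_two) p) h
  simp_rw [Real.div_rpow (approxNumber_nonneg T _) zero_le_two] at h1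
  exact (summable_div_const_iff (by positivity)).1 h1

/-- Greedy choice: given at most `N` chosen indices, some other index has `s k ≥ a_N / 2`, as
otherwise truncation would give `a_N ≤ a_N / 2`. -/
lemma summable_approxNumber_of_eigenbasis {ι : Type*} (ψ : HilbertBasis ι ℂ H₁)
    {T : H₁ →L[ℂ] H₂} {s : ι → ℝ} {p : ℝ} (hp : 0 < p) (hs : ∀ k, 0 ≤ s k)
    (h : ∀ k, adjoint T (T (ψ k)) = (s k : ℂ) ^ 2 • ψ k) (hsum : Summable fun k => s k ^ p) :
    Summable fun n => approxNumber T n ^ p := by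
  classical
  have key : ∀ N, ∃ A : Finset ι, A.card ≤ N ∧
      ∑ n ∈ Finset.range N, (approxNumber T n / 2) ^ p ≤ ∑ k ∈ A, s k ^ p := by
    intro N
    induction N with
    | zero => exact ⟨∅, by simp⟩
    | succ N ih =>
      obtain ⟨A, hA, hsA⟩ := ih
      have ha := approxNumber_nonneg T N
      -- If `a_N = 0`, there may be no further index to choose, but the new term of the sum
      -- vanishes, so the old set still works.
      rcases ha.eq_or_lt with h0 | h0
      · refine ⟨A, hA.trans N.le_succ, ?_⟩
        rwa [Finset.sum_range_succ, ← h0, zero_div, Real.zero_rpow hp.ne', add_zero]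
      have hk : ∃ k ∉ A, approxNumber T N / 2 ≤ s k := by
        by_contra! hk
        have := approxNumber_card_le ψ hs h hA (by positivity) fun k hkA => (hk k hkA).le
        linarith
      obtain ⟨k, hkA, hk⟩ := hk
      refine ⟨insert k A, (Finset.card_insert_le _ _).trans (Nat.succ_le_succ hA), ?_⟩
      rw [Finset.sum_range_succ, Finset.sum_insert hkA, add_comm]
      gcongr
  refine summable_approxNumber_of_sum_range_le (C := ∑' k, s k ^ p) fun N => ?_
  obtain ⟨A, -, hA⟩ := key N
  exact hA.trans (hsum.sum_le_tsum A fun k _ => Real.rpow_nonneg (hs k) p)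

/-- The indices are inserted in order of decreasing `s`: the new `s k` is the least of `A.card + 1`
singular values, hence at most the approximation number of index `A.card`. -/
lemma sum_rpow_le_sum_approxNumber {ι : Type*} (ψ : HilbertBasis ι ℂ H₁) {T : H₁ →L[ℂ] H₂}
    {s : ι → ℝ} {p : ℝ} (hp : 0 < p) (hs : ∀ k, 0 ≤ s k)
    (h : ∀ k, adjoint T (T (ψ k)) = (s k : ℂ) ^ 2 • ψ k) (A : Finset ι) :
    ∑ k ∈ A, s k ^ p ≤ ∑ n ∈ Finset.range A.card, approxNumber T n ^ p := by
  classical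
  induction A using Finset.induction_on_min_value s with
  | empty => simp
  | insert k A hk hmin ih =>
    rw [Finset.sum_insert hk, Finset.card_insert_of_notMem hk, Finset.sum_range_succ, add_comm]
    refine add_le_add ih (Real.rpow_le_rpow (hs k) ?_ hp.le)
    refine le_approxNumber_card ψ h (A := insert k A) ?_ (hs k) ?_
    · rw [Finset.card_insert_of_notMem hk]
      exact Nat.lt_succ_self _
    · simpa using hmin

/-- Spectral theorem in the form needed for `T*T`: Hilbert bases of all eigenspaces, kernel
included, are glued together. The eigenspaces are mutually orthogonal and jointly have trivial
orthogonal complement. -/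
lemma exists_hilbertBasis_eigenvectors {A : H →L[ℂ] H} (hA : IsCompactOperator A)
    (hA' : A.IsSymmetric) :
    ∃ (w : Set H) (ψ : HilbertBasis w ℂ H) (l : w → ℂ), ∀ k, A (ψ k) = l k • ψ k := by
  let V (l : ℂ) : Submodule ℂ H := Module.End.eigenspace (A : Module.End ℂ H) l
  have hmem {l : ℂ} {x : H} : x ∈ V l ↔ A x = l • x := Module.End.mem_eigenspace_iff
  have hcl (l : ℂ) : IsClosed (V l : Set H) := by
    have : (V l : Set H) = {x | A x = l • x} := Set.ext fun _ => hmem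
    rw [this]
    exact isClosed_eq A.continuous (continuous_const_smul l)
  have (l : ℂ) : CompleteSpace (V l) := (hcl l).completeSpace_coe
  choose w b _ using fun l => exists_hilbertBasis ℂ (V l)
  have hv := hA'.orthogonalFamily_eigenspaces.orthonormal_sigma_orthonormal
    (fun l => (b l).orthonormal)
  let v : (Σ l : ℂ, w l) → H := fun a => (b a.1 a.2 : H)
  have hv' : Orthonormal ℂ v := hv
  have hbot : (Submodule.span ℂ (Set.range ((↑) : Set.range v → H)))ᗮ = ⊥ := by
    rw [Subtype.range_coe, eq_bot_iff,
      ← ContinuousLinearMap.orthogonalComplement_iSup_eigenspaces_eq_bot hA hA']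
    refine (Submodule.le_orthogonal_orthogonal _).trans
      (Submodule.orthogonal_le (iSup_le fun l x hx => ?_))
    -- Each eigenspace lies in the double complement of the glued system: `U` is closed in `V l` and
    -- contains a Hilbert basis of `V l`, so it is everything.
    let U : Submodule ℂ (V l) := ((Submodule.span ℂ (Set.range v))ᗮᗮ).comap (V l).subtype
    have hU : IsClosed (U : Set (V l)) :=
      (Submodule.isClosed_orthogonal _).preimage continuous_subtype_val
    have hle : (Submodule.span ℂ (Set.range (b l))).topologicalClosure ≤ U := by
      refine Submodule.topologicalClosure_minimal _ (Submodule.span_le.2 ?_) hU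
      rintro _ ⟨k, rfl⟩
      exact Submodule.le_orthogonal_orthogonal _ (Submodule.subset_span ⟨⟨l, k⟩, rfl⟩)
    rw [(b l).dense_span] at hle
    exact hle (Submodule.mem_top : (⟨x, hx⟩ : V l) ∈ ⊤)
  have hl (k : Set.range v) : ∃ l : ℂ, A k = l • (k : H) := by
    obtain ⟨_, ⟨l, k⟩, rfl⟩ := k
    exact ⟨l, hmem.1 (b l k).2⟩
  choose l hl using hl
  refine ⟨Set.range v, HilbertBasis.mkOfOrthogonalEqBot hv'.toSubtypeRange hbot, l, fun k => ?_⟩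
  rw [HilbertBasis.coe_mkOfOrthogonalEqBot]
  exact hl k

theorem isSchatten_iff_summable_approxNumber {T : H₁ →L[ℂ] H₂} {p : ℝ} (hp : 0 < p) :
    IsSchatten p T ↔ Summable fun n => approxNumber T n ^ p := by
  constructor
  · rintro ⟨-, w, ψ, s, hs, hψ, hsum⟩
    exact summable_approxNumber_of_eigenbasis ψ hp hs
      (fun k => (absOp_apply_eq_smul_iff (hs k)).1 (hψ k)) hsum
  · intro hsum
    have hT := isCompactOperator_of_approxNumber_summable hp hsum
    obtain ⟨w, ψ, l, hl⟩ := exists_hilbertBasis_eigenvectors (A := (adjoint T).comp T)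
      (hT.clm_comp (adjoint T)) (ContinuousLinearMap.isPositive_adjoint_comp_self T).isSymmetric
    -- Pairing the eigenvalue equation with the unit vector `ψ k` identifies `l k` as `‖T (ψ k)‖²`,
    -- so the singular values are `‖T (ψ k)‖`.
    have hψ (k : w) : adjoint T (T (ψ k)) = (‖T (ψ k)‖ : ℂ) ^ 2 • ψ k := by
      have h1 : adjoint T (T (ψ k)) = l k • ψ k := hl k
      have h2 : inner ℂ (ψ k) (adjoint T (T (ψ k))) = (‖T (ψ k)‖ : ℂ) ^ 2 := by
        rw [ContinuousLinearMap.adjoint_inner_right, inner_self_eq_norm_sq_to_K]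
        rfl
      rw [h1, inner_smul_right, inner_self_eq_norm_sq_to_K, ψ.orthonormal.1 k] at h2
      rw [h1, ← h2]
      simp
    refine ⟨hT, w, ψ, fun k => ‖T (ψ k)‖, fun k => norm_nonneg _,
      fun k => (absOp_apply_eq_smul_iff (norm_nonneg _)).2 (hψ k), ?_⟩
    refine summable_of_sum_le (fun k => Real.rpow_nonneg (norm_nonneg _) p) fun A =>
      (sum_rpow_le_sum_approxNumber ψ hp (fun k => norm_nonneg _) hψ A).trans
        (hsum.sum_le_tsum _ fun n _ => Real.rpow_nonneg (approxNumber_nonneg T n) p)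

/-- An operator whose sums `∑ ‖T x‖ ^ 2` over finite orthonormal sets are bounded is
Hilbert-Schmidt. -/
theorem summable_approxNumber_of_sum_orthonormal_le {T : H₁ →L[ℂ] H₂} {C : ℝ}
    (hC : ∀ A : Finset H₁, Orthonormal ℂ ((↑) : A → H₁) → ∑ x ∈ A, ‖T x‖ ^ 2 ≤ C) :
    Summable fun n => approxNumber T n ^ (2 : ℝ) := by
  classical
  have key : ∀ N, ∃ A : Finset H₁, Orthonormal ℂ ((↑) : A → H₁) ∧ A.card ≤ N ∧
      ∑ n ∈ Finset.range N, (approxNumber T n / 2) ^ (2 : ℝ) ≤ ∑ x ∈ A, ‖T x‖ ^ 2 := by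
    intro N
    induction N with
    | zero => exact ⟨∅, by simp⟩
    | succ N ih =>
      obtain ⟨A, hAo, hA, hsA⟩ := ih
      have ha := approxNumber_nonneg T N
      rcases ha.eq_or_lt with h0 | h0
      · refine ⟨A, hAo, hA.trans N.le_succ, ?_⟩
        rwa [Finset.sum_range_succ, ← h0, zero_div, Real.zero_rpow two_ne_zero, add_zero]
      set V := Submodule.span ℂ (A : Set H₁) with hV
      -- The same greedy choice, now without eigenvectors: otherwise `T` would have norm at most
      -- `a_N / 2` on `Vᗮ`, and subtracting `T P_V`, of rank at most `N`, would give `a_N ≤ a_N /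
      -- 2`.
      have hx : ∃ x ∈ Vᗮ, ‖x‖ = 1 ∧ approxNumber T N / 2 ≤ ‖T x‖ := by
        by_contra! hx
        have hr : HasRankLE V.starProjection N :=
          ⟨A, hA, fun x => Submodule.starProjection_apply_mem _ _⟩
        have h1 : approxNumber T N ≤ approxNumber T N / 2 := by
          refine (approxNumber_le (hr.comp_left T)).trans
            (ContinuousLinearMap.opNorm_le_bound _ (by positivity) fun x => ?_)
          set y := x - V.starProjection x with hy
          have hyV : y ∈ Vᗮ := Submodule.sub_starProjection_mem_orthogonal x
          have hyx : ‖y‖ ≤ ‖x‖ := by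
            have : y = Vᗮ.starProjection x := by
              rw [Submodule.starProjection_orthogonal']
              rfl
            rw [this]
            exact Submodule.norm_starProjection_apply_le _ _
          have hTy : (T - T.comp V.starProjection) x = T y := by simp [hy]
          rw [hTy]
          refine le_trans ?_ (mul_le_mul_of_nonneg_left hyx (by positivity))
          rcases eq_or_ne y 0 with hy0 | hy0
          · simp [hy0]
          have hn : ‖y‖ ≠ 0 := norm_ne_zero_iff.2 hy0
          have h2 := (hx (((‖y‖⁻¹ : ℝ) : ℂ) • y) (Submodule.smul_mem _ _ hyV) (by
            rw [norm_smul, Complex.norm_real, norm_inv, norm_norm, inv_mul_cancel₀ hn])).le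
          rw [map_smul, norm_smul, Complex.norm_real, norm_inv, norm_norm,
            inv_mul_le_iff₀ (by positivity)] at h2
          linarith
        linarith
      obtain ⟨x, hxV, hx1, hxT⟩ := hx
      have hort (y : H₁) (hy : y ∈ A) : inner ℂ y x = 0 :=
        Submodule.inner_right_of_mem_orthogonal (Submodule.subset_span hy) hxV
      have hxA : x ∉ A := fun hxA => by
        have := hort x hxA
        rw [inner_self_eq_zero] at this
        simp [this] at hx1
      refine ⟨insert x A, ?_, (Finset.card_insert_le _ _).trans (Nat.succ_le_succ hA), ?_⟩
      · have hAo' := orthonormal_subtype_iff_ite (s := (A : Set H₁)).1 hAo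
        refine orthonormal_subtype_iff_ite (s := ((insert x A : Finset H₁) : Set H₁)).2 ?_
        intro y hy z hz
        rw [Finset.mem_coe, Finset.mem_insert] at hy hz
        rcases hy with rfl | hy <;> rcases hz with rfl | hz
        · simp [inner_self_eq_norm_sq_to_K, hx1]
        · rw [inner_eq_zero_symm.1 (hort z hz), if_neg (ne_of_mem_of_not_mem hz hxA).symm]
        · rw [hort y hy, if_neg (ne_of_mem_of_not_mem hy hxA)]
        · exact hAo' y hy z hz
      · rw [Finset.sum_range_succ, Finset.sum_insert hxA, add_comm, Real.rpow_two]
        gcongr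
  refine summable_approxNumber_of_sum_range_le (C := C) fun N => ?_
  obtain ⟨A, hAo, -, hA⟩ := key N
  exact hA.trans (hC A hAo)

end SingularValues

/-! ### Complex conjugation on `L²` -/

section Conjugation

variable {Ω : Type*} [MeasurableSpace Ω] {μ : Measure Ω}

open ContinuousLinearMap (adjoint)

lemma Lp_star_add (f g : Lp ℂ 2 μ) : star (f + g) = star f + star g := by
  refine Lp.ext ?_
  filter_upwards [Lp.coeFn_star (f + g), Lp.coeFn_star f, Lp.coeFn_star g, Lp.coeFn_add f g,
    Lp.coeFn_add (star f) (star g)] with x h1 h2 h3 h4 h5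
  rw [h1, h5, Pi.star_apply, h4, Pi.add_apply, Pi.add_apply, h2, h3, Pi.star_apply, Pi.star_apply,
    star_add]

lemma Lp_star_smul (c : ℂ) (f : Lp ℂ 2 μ) : star (c • f) = star c • star f := by
  refine Lp.ext ?_
  filter_upwards [Lp.coeFn_star (c • f), Lp.coeFn_star f, Lp.coeFn_smul c f,
    Lp.coeFn_smul (star c) (star f)] with x h1 h2 h3 h4
  rw [h1, h4, Pi.star_apply, h3, Pi.smul_apply, Pi.smul_apply, h2, Pi.star_apply, smul_eq_mul,
    smul_eq_mul, star_mul']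

lemma Lp_norm_star (f : Lp ℂ 2 μ) : ‖star f‖ = ‖f‖ := by
  refine le_antisymm (Lp.norm_le_norm_of_ae_le ?_) (Lp.norm_le_norm_of_ae_le ?_) <;>
  · filter_upwards [Lp.coeFn_star f] with x h
    simp [h]

/-- `∫ g f = ⟪f̄, g⟫`. -/
lemma integral_mul_eq_inner_star (f φ : Lp ℂ 2 μ) {g : Ω → ℂ} (hg : φ =ᵐ[μ] g) :
    ∫ y, g y * f y ∂μ = inner ℂ (star f) φ := by
  rw [L2.inner_def]
  refine integral_congr_ae ?_
  filter_upwards [hg, Lp.coeFn_star f] with y h1 h2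
  simp [h1, h2]

lemma Lp_inner_star_star (f g : Lp ℂ 2 μ) : inner ℂ (star f) (star g) = inner ℂ g f := by
  rw [L2.inner_def, L2.inner_def]
  refine integral_congr_ae ?_
  filter_upwards [Lp.coeFn_star f, Lp.coeFn_star g] with y h1 h2
  simp [h1, h2, mul_comm]

/-- The operator `f ↦ conj (R (conj f))`. -/
noncomputable def conjOp (R : Lp ℂ 2 μ →L[ℂ] Lp ℂ 2 μ) : Lp ℂ 2 μ →L[ℂ] Lp ℂ 2 μ :=
  LinearMap.mkContinuous
    { toFun := fun f => star (R (star f))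
      map_add' := fun f g => by rw [Lp_star_add, map_add, Lp_star_add]
      map_smul' := fun c f => by
        rw [Lp_star_smul, map_smul, Lp_star_smul, star_star, RingHom.id_apply] }
    ‖R‖ fun f => by
      rw [← Lp_norm_star f]
      exact (Lp_norm_star _).trans_le (R.le_opNorm _)

lemma conjOp_apply (R : Lp ℂ 2 μ →L[ℂ] Lp ℂ 2 μ) (f : Lp ℂ 2 μ) :
    conjOp R f = star (R (star f)) := rfl

lemma norm_conjOp_le (R : Lp ℂ 2 μ →L[ℂ] Lp ℂ 2 μ) : ‖conjOp R‖ ≤ ‖R‖ :=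
  LinearMap.mkContinuous_norm_le _ (norm_nonneg _) _

lemma conjOp_sub (R S : Lp ℂ 2 μ →L[ℂ] Lp ℂ 2 μ) : conjOp (R - S) = conjOp R - conjOp S := by
  ext1 f
  have h : star (R (star f) - S (star f)) = star (R (star f)) - star (S (star f)) := by
    rw [eq_sub_iff_add_eq, ← Lp_star_add, sub_add_cancel]
  exact h

lemma HasRankLE.conjOp {F : Lp ℂ 2 μ →L[ℂ] Lp ℂ 2 μ} {n : ℕ} (hF : HasRankLE F n) :
    HasRankLE (conjOp F) n := by
  classical
  obtain ⟨s, hs, hF⟩ := hF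
  refine ⟨s.image star, Finset.card_image_le.trans hs, fun x => ?_⟩
  rw [conjOp_apply]
  have hx := hF (star x)
  generalize F (star x) = y at hx
  induction hx using Submodule.span_induction with
  | mem y hy => exact Submodule.subset_span (Finset.mem_coe.2 (Finset.mem_image_of_mem _ hy))
  | zero =>
    have h : star (0 : Lp ℂ 2 μ) = 0 := by rw [← norm_eq_zero, Lp_norm_star, norm_zero]
    rw [h]
    exact zero_mem _
  | add y z _ _ hy hz =>
    rw [Lp_star_add]
    exact add_mem hy hz
  | smul c y _ hy =>
    rw [Lp_star_smul]
    exact Submodule.smul_mem _ _ hy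

lemma approxNumber_conjOp_le (R : Lp ℂ 2 μ →L[ℂ] Lp ℂ 2 μ) (n : ℕ) :
    approxNumber (conjOp R) n ≤ approxNumber R n :=
  le_approxNumber fun F hF =>
    (approxNumber_le hF.conjOp).trans (conjOp_sub R F ▸ norm_conjOp_le (R - F))

/-- `conjOp (adjoint R)` is the transpose of `R` for the pairing `∫ f g`, the form in which `R₁`
enters the factorization. Neither the adjoint nor the conjugation increases approximation numbers.
-/
lemma summable_approxNumber_conjOp_adjoint {R : Lp ℂ 2 μ →L[ℂ] Lp ℂ 2 μ} {p : ℝ} (hp : 0 < p)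
    (hR : Summable fun n => approxNumber R n ^ p) :
    Summable fun n => approxNumber (conjOp (adjoint R)) n ^ p :=
  hR.of_nonneg_of_le (fun _ => Real.rpow_nonneg (approxNumber_nonneg _ _) _) fun n =>
    Real.rpow_le_rpow (approxNumber_nonneg _ _)
      ((approxNumber_conjOp_le _ n).trans (approxNumber_adjoint_le R n)) hp.le

end Conjugation

/-! ### Kernels in the range of an operator acting on one variable -/

section Factorization

variable {Ω₁ Ω₂ : Type*} [MeasurableSpace Ω₁] [MeasurableSpace Ω₂]
  {μ₁ : Measure Ω₁} {μ₂ : Measure Ω₂} [SigmaFinite μ₁] [SigmaFinite μ₂] {K F : Ω₂ × Ω₁ → ℂ}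

open ContinuousLinearMap (adjoint)

/-- An integral operator with square integrable kernel is Hilbert-Schmidt. -/
theorem summable_approxNumber_integralOperator (hK : MemLp K 2 (μ₂.prod μ₁)) :
    Summable fun n => approxNumber (integralOperator K hK) n ^ (2 : ℝ) := by
  refine summable_approxNumber_of_sum_orthonormal_le
    (C := (eLpNorm K 2 (μ₂.prod μ₁) ^ 2).toReal) fun A hA => ?_
  -- Conjugates appear because `(T e)(x) = ∫ K(x, y) e(y)` is the inner product of `star e` with the
  -- fibre `K(x, ·)`.
  have hA' : Orthonormal ℂ fun e : A => star (e : Lp ℂ 2 μ₁) := by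
    classical
    refine orthonormal_iff_ite.2 fun i j => ?_
    rw [Lp_inner_star_star, orthonormal_iff_ite.1 hA]
    simp [eq_comm]
  have hle : ∑ e ∈ A, ‖integralOperator K hK e‖ₑ ^ 2 ≤ eLpNorm K 2 (μ₂.prod μ₁) ^ 2 := by
    simp_rw [Lp.enorm_def, eLpNorm_two_sq μ₂]
    rw [← lintegral_fiber_eLpNorm hK, ← lintegral_finsetSum' _ fun e _ =>
      (Lp.aestronglyMeasurable (integralOperator K hK e)).enorm.pow_const 2]
    refine lintegral_mono_ae ?_
    have hall : ∀ᵐ x ∂μ₂, ∀ e : A,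
        integralOperator K hK e x = ∫ y, K (x, y) * (e : Lp ℂ 2 μ₁) y ∂μ₁ :=
      ae_all_iff.2 fun e => integralOperator_ae hK e
    filter_upwards [fiber_memLp hK, hall] with x hx hxe
    -- Bessel's inequality on the fibre over `x`: `∑ |(T e)(x)|² ≤ ‖K(x, ·)‖²`. Integrating over `x`
    -- gives the bound.
    have hb := hA'.sum_inner_products_le (s := Finset.univ) (hx.toLp _)
    simp_rw [← integral_mul_eq_inner_star _ _ hx.coeFn_toLp, ← hxe] at hb
    rw [Finset.sum_coe_sort A fun e => ‖integralOperator K hK e x‖ ^ 2] at hb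
    rw [← Lp.enorm_toLp hx, ← ofReal_norm, ← ENNReal.ofReal_pow (norm_nonneg _)]
    refine le_trans (le_of_eq ?_) (ENNReal.ofReal_le_ofReal hb)
    rw [ENNReal.ofReal_sum_of_nonneg fun _ _ => by positivity]
    exact Finset.sum_congr rfl fun e _ => by
      rw [← ofReal_norm, ENNReal.ofReal_pow (norm_nonneg _)]
  have h := ENNReal.toReal_mono (ENNReal.pow_ne_top hK.2.ne) hle
  rwa [ENNReal.toReal_sum fun _ _ => ENNReal.pow_ne_top enorm_ne_top,
    Finset.sum_congr rfl fun e _ => by rw [ENNReal.toReal_pow, toReal_enorm]] at h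

/-- If `K(x, ·) = R F(x, ·)` then `T_K = T_F ∘ Rᵗ`, where `Rᵗ` is the transpose of `R`. -/
theorem integralOperator_eq_comp_conjOp (hK : MemLp K 2 (μ₂.prod μ₁))
    (hF : MemLp F 2 (μ₂.prod μ₁)) {R : Lp ℂ 2 μ₁ →L[ℂ] Lp ℂ 2 μ₁}
    (h : ∀ᵐ x ∂μ₂, ∃ φ : Lp ℂ 2 μ₁, φ =ᵐ[μ₁] (fun y => F (x, y)) ∧
      R φ =ᵐ[μ₁] fun y => K (x, y)) :
    integralOperator K hK = (integralOperator F hF).comp (conjOp (adjoint R)) := by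
  ext1 f
  refine Lp.ext ?_
  filter_upwards [h, integralOperator_ae hK f, integralOperator_ae hF (conjOp (adjoint R) f)]
    with x ⟨φ, hφ, hRφ⟩ h1 h2
  rw [ContinuousLinearMap.comp_apply, h1, h2, integral_mul_eq_inner_star f _ hRφ,
    integral_mul_eq_inner_star _ _ hφ, conjOp_apply, star_star,
    ContinuousLinearMap.adjoint_inner_left]

lemma memLp_two_mul_prod {f : Ω₂ → ℂ} {g : Ω₁ → ℂ} (hf : MemLp f 2 μ₂) (hg : MemLp g 2 μ₁) :
    MemLp (fun z : Ω₂ × Ω₁ => f z.1 * g z.2) 2 (μ₂.prod μ₁) := by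
  refine (memLp_two_iff_integrable_sq_norm (hf.1.comp_fst.mul hg.1.comp_snd)).2 ?_
  simpa [mul_pow] using ((memLp_two_iff_integrable_sq_norm hf.1).1 hf).mul_prod
    ((memLp_two_iff_integrable_sq_norm hg.1).1 hg)

/-- Fubini, justified since `K` and the product of `star g` and `f` are both square integrable. It
exposes the fibres `K(·, y)`, whereas the defining formula of the operator uses `K(x, ·)`. -/
lemma inner_integralOperator (hK : MemLp K 2 (μ₂.prod μ₁)) (g : Lp ℂ 2 μ₂) (f : Lp ℂ 2 μ₁) :
    inner ℂ g (integralOperator K hK f) =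
      ∫ y, (∫ x, K (x, y) * (star g : Lp ℂ 2 μ₂) x ∂μ₂) * f y ∂μ₁ := by
  have hint : Integrable (fun z : Ω₂ × Ω₁ => K z * ((star g : Lp ℂ 2 μ₂) z.1 * f z.2))
      (μ₂.prod μ₁) := hK.integrable_mul (memLp_two_mul_prod (Lp.memLp _) (Lp.memLp f))
  have hl : inner ℂ g (integralOperator K hK f) =
      ∫ x, ∫ y, K (x, y) * ((star g : Lp ℂ 2 μ₂) x * f y) ∂μ₁ ∂μ₂ := by
    rw [L2.inner_def]
    refine integral_congr_ae ?_
    filter_upwards [integralOperator_ae hK f, Lp.coeFn_star g] with x h1 h2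
    rw [h1, h2, RCLike.inner_apply, mul_comm, ← integral_const_mul]
    refine integral_congr_ae (Filter.Eventually.of_forall fun y => ?_)
    simp only [Pi.star_apply, RCLike.star_def]
    ring
  rw [hl, integral_integral_swap (f := fun x y => K (x, y) * ((star g : Lp ℂ 2 μ₂) x * f y)) hint]
  refine integral_congr_ae (Filter.Eventually.of_forall fun y => ?_)
  simp only [← integral_mul_const, mul_assoc]

/-- If `K(·, y) = R F(·, y)` then `T_K = R ∘ T_F`. -/
theorem integralOperator_eq_comp (hK : MemLp K 2 (μ₂.prod μ₁))
    (hF : MemLp F 2 (μ₂.prod μ₁)) {R : Lp ℂ 2 μ₂ →L[ℂ] Lp ℂ 2 μ₂}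
    (h : ∀ᵐ y ∂μ₁, ∃ φ : Lp ℂ 2 μ₂, φ =ᵐ[μ₂] (fun x => F (x, y)) ∧
      R φ =ᵐ[μ₂] fun x => K (x, y)) :
    integralOperator K hK = R.comp (integralOperator F hF) := by
  ext1 f
  -- The identity is tested weakly: the hypothesis concerns fibres in `x`, so `R` is moved to `g` as
  -- its adjoint and the inner integrals are compared for almost every `y`.
  refine ext_inner_left ℂ fun g => ?_
  rw [ContinuousLinearMap.comp_apply, ← ContinuousLinearMap.adjoint_inner_left R,
    inner_integralOperator, inner_integralOperator]
  refine integral_congr_ae ?_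
  filter_upwards [h] with y ⟨φ, hφ, hRφ⟩
  rw [integral_mul_eq_inner_star _ _ hφ, integral_mul_eq_inner_star _ _ hRφ, star_star, star_star,
    ContinuousLinearMap.adjoint_inner_left]

/-- If `K(·, y) = R F(·, y)` with `F` square integrable, then `K` is square integrable. -/
lemma memLp_of_fiber_eq (hK : AEStronglyMeasurable K (μ₂.prod μ₁)) (hF : MemLp F 2 (μ₂.prod μ₁))
    {R : Lp ℂ 2 μ₂ →L[ℂ] Lp ℂ 2 μ₂}
    (h : ∀ᵐ y ∂μ₁, ∃ φ : Lp ℂ 2 μ₂, φ =ᵐ[μ₂] (fun x => F (x, y)) ∧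
      R φ =ᵐ[μ₂] fun x => K (x, y)) :
    MemLp K 2 (μ₂.prod μ₁) := by
  refine ⟨hK, ?_⟩
  have hle : eLpNorm K 2 (μ₂.prod μ₁) ^ 2 ≤ ‖R‖ₑ ^ 2 * eLpNorm F 2 (μ₂.prod μ₁) ^ 2 := by
    simp_rw [eLpNorm_two_sq]
    rw [lintegral_prod_symm _ (hK.enorm.pow_const 2),
      lintegral_prod_symm _ (hF.1.enorm.pow_const 2),
      ← lintegral_const_mul' _ _ (ENNReal.pow_ne_top enorm_ne_top)]
    refine lintegral_mono_ae ?_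
    filter_upwards [h] with y ⟨φ, hφ, hRφ⟩
    rw [← eLpNorm_two_sq μ₂ fun x => K (x, y), ← eLpNorm_two_sq μ₂ fun x => F (x, y),
      ← eLpNorm_congr_ae hφ, ← eLpNorm_congr_ae hRφ, ← Lp.enorm_def, ← Lp.enorm_def, ← mul_pow]
    gcongr
    exact R.le_opENorm φ
  have hfin : eLpNorm K 2 (μ₂.prod μ₁) ^ 2 < ∞ :=
    hle.trans_lt (ENNReal.mul_lt_top (ENNReal.pow_lt_top enorm_lt_top) (ENNReal.pow_lt_top hF.2))
  by_contra hK'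
  rw [not_lt, top_le_iff] at hK'
  simp [hK'] at hfin

lemma ActsOnX.exists_inverse {E : Lp ℂ 2 μ₂ →ₗ.[ℂ] Lp ℂ 2 μ₂} {R : Lp ℂ 2 μ₂ →L[ℂ] Lp ℂ 2 μ₂}
    (hR : IsInverseOf R E) (h : ActsOnX μ₁ μ₂ E K F) :
    ∀ᵐ y ∂μ₁, ∃ φ : Lp ℂ 2 μ₂, φ =ᵐ[μ₂] (fun x => F (x, y)) ∧ R φ =ᵐ[μ₂] fun x => K (x, y) :=
  h.mono fun _ ⟨φ, h1, h2⟩ => ⟨E φ, h2, (hR.left_inv φ).symm ▸ h1⟩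

lemma ActsOnY.exists_inverse {E : Lp ℂ 2 μ₁ →ₗ.[ℂ] Lp ℂ 2 μ₁} {R : Lp ℂ 2 μ₁ →L[ℂ] Lp ℂ 2 μ₁}
    (hR : IsInverseOf R E) (h : ActsOnY μ₁ μ₂ E K F) :
    ∀ᵐ x ∂μ₂, ∃ φ : Lp ℂ 2 μ₁, φ =ᵐ[μ₁] (fun y => F (x, y)) ∧ R φ =ᵐ[μ₁] fun y => K (x, y) :=
  h.mono fun _ ⟨φ, h1, h2⟩ => ⟨E φ, h2, (hR.left_inv φ).symm ▸ h1⟩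

end Factorization

/-! ### Schatten exponents for the three smoothness conditions -/

theorem mainTheorem1 {Ω₁ Ω₂ : Type*} [MeasurableSpace Ω₁] [MeasurableSpace Ω₂]
    (μ₁ : Measure Ω₁) (μ₂ : Measure Ω₂) [SigmaFinite μ₁] [SigmaFinite μ₂]
    (E₁ : Lp ℂ 2 μ₁ →ₗ.[ℂ] Lp ℂ 2 μ₁) (E₂ : Lp ℂ 2 μ₂ →ₗ.[ℂ] Lp ℂ 2 μ₂)
    (hE₁ : Dense (E₁.domain : Set (Lp ℂ 2 μ₁))) (hE₂ : Dense (E₂.domain : Set (Lp ℂ 2 μ₂)))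
    (p₁ p₂ : ℝ) (hp₁ : 0 < p₁) (hp₂ : 0 < p₂)
    (hS₁ : InverseIsSchatten p₁ E₁) (hS₂ : InverseIsSchatten p₂ E₂)
    (K : Ω₂ × Ω₁ → ℂ) (hK : MemLp K 2 (μ₂.prod μ₁)) :
    (XYImageMemL2 μ₁ μ₂ E₁ E₂ K →
      ∀ r : ℝ, 1 / r = 1 / 2 + 1 / p₁ + 1 / p₂ → IsSchatten r (integralOperator K hK)) ∧
    (XImageMemL2 μ₁ μ₂ E₂ K →
      ∀ r : ℝ, 1 / r = 1 / 2 + 1 / p₂ → IsSchatten r (integralOperator K hK)) ∧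
    (YImageMemL2 μ₁ μ₂ E₁ K →
      ∀ r : ℝ, 1 / r = 1 / 2 + 1 / p₁ → IsSchatten r (integralOperator K hK)) := by
  obtain ⟨R₁, hR₁, hS₁⟩ := hS₁
  obtain ⟨R₂, hR₂, hS₂⟩ := hS₂
  replace hS₁ := summable_approxNumber_conjOp_adjoint hp₁
    ((isSchatten_iff_summable_approxNumber hp₁).1 hS₁)
  replace hS₂ := (isSchatten_iff_summable_approxNumber hp₂).1 hS₂
  -- Stated for a general kernel because it serves twice: for `K` itself in (ii), and for `G =
  -- (E₁)_y K` in (i).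
  have hX {G : Ω₂ × Ω₁ → ℂ} (hG : MemLp G 2 (μ₂.prod μ₁)) (h : XImageMemL2 μ₁ μ₂ E₂ G) {r : ℝ}
      (hr : 1 / r = 1 / 2 + 1 / p₂) :
      Summable fun n => approxNumber (integralOperator G hG) n ^ r := by
    obtain ⟨F, hF, h⟩ := h
    rw [integralOperator_eq_comp hG hF (h.exists_inverse hR₂)]
    exact approxNumber_summable_comp hp₂ two_pos (by rw [hr, add_comm]) hS₂
      (summable_approxNumber_integralOperator hF)
  refine ⟨fun ⟨G, hGm, hG, hGX⟩ r hr => ?_, fun h r hr => ?_, fun ⟨F, hF, h⟩ r hr => ?_⟩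
  · have hr0 : 0 < r := one_div_pos.1 (hr ▸ by positivity)
    obtain ⟨F, hF, hGF⟩ := id hGX
    -- `G` is only assumed measurable; boundedness of `R₂` on the fibres makes it square integrable,
    -- so that it defines an integral operator.
    have hGL : MemLp G 2 (μ₂.prod μ₁) := memLp_of_fiber_eq hGm hF (hGF.exists_inverse hR₂)
    rw [isSchatten_iff_summable_approxNumber hr0,
      integralOperator_eq_comp_conjOp hK hGL (hG.exists_inverse hR₁)]
    -- The intermediate exponent is that of `T_G`; composing with the transpose of `R₁` adds `1 /
    -- p₁`.
    have hq : 1 / (1 / 2 + 1 / p₂)⁻¹ = 1 / 2 + 1 / p₂ := by rw [one_div, inv_inv]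
    exact approxNumber_summable_comp (p := (1 / 2 + 1 / p₂)⁻¹) (by positivity) hp₁
      (by rw [hq, hr]; ring) (hX hGL hGX hq) hS₁
  · have hr0 : 0 < r := one_div_pos.1 (hr ▸ by positivity)
    exact (isSchatten_iff_summable_approxNumber hr0).2 (hX hK h hr)
  · have hr0 : 0 < r := one_div_pos.1 (hr ▸ by positivity)
    rw [isSchatten_iff_summable_approxNumber hr0,
      integralOperator_eq_comp_conjOp hK hF (h.exists_inverse hR₁)]
    exact approxNumber_summable_comp two_pos hp₁ hr
      (summable_approxNumber_integralOperator hF) hS₁
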